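/- Fix an algebraic closure $\overline{\mathbb Q}$ of $\mathbb Q$; all fields are subfields of $\overline{\mathbb Q}$. Let $H$ denote the absolute non-logarithmic Weil height on $\overline{\mathbb Q}$. A subset $\mathcal A\subseteq\overline{\mathbb Q}$ has the Northcott property if for every real $X>0$ there are only finitely many $\alpha\in\mathcal A$ with $H(\alpha)\le X$. A prime number $p$ ramifies totally in a number field $K$ if $p\mathcal O_K=\mathfrak P^{[K:\mathbb Q]}$ for a prime ideal $\mathfrak P$ of $\mathcal O_K$. Let $d$ be a positive integer, let $F_0$ be a number field, and let $F_1,F_2,F_3,\dots$ be a sequence of finite extensions of $F_0$ with $[F_i:F_0]\le d$ for all $i\ge 1$. Suppose that there is a sequence $p_1,p_2,p_3,\dots$ of positive prime numbers such that, for every $i\ge 1$, $p_i$ ramifies totally in $F_i$ but does not ramify in $F_j$ for $1\le j<i$. Then the compositum of $F_0,F_1,F_2,F_3,\dots$ has the Northcott property. -/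

import Mathlib

open scoped NumberField

/-- A set of algebraic numbers has the Northcott property if for each positive real `X` it contains
only finitely many elements of absolute (non-logarithmic) Weil height at most `X`. -/
def HasNorthcottProperty (A : Set (AlgebraicClosure ℚ)) : Prop :=
  ∀ X : ℝ, 0 < X → {α | α ∈ A ∧ NumberField.absMulHeight₁ α ≤ X}.Finite

/-- The rational prime `p` ramifies totally in the number field `K`: the ideal `p 𝓞 K` is the
`[K : ℚ]`-th power of a prime ideal. -/
def RamifiesTotallyIn (p : ℕ) (K : Type*) [Field K] [NumberField K] : Prop :=
  ∃ P : Ideal (𝓞 K), P.IsPrime ∧ Ideal.span {(p : 𝓞 K)} = P ^ Module.finrank ℚ K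

/-- The rational prime `p` ramifies in the number field `K`: some prime ideal of `𝓞 K` above `p`
is ramified over `ℤ`. -/
def RamifiesIn (p : ℕ) (K : Type*) [Field K] [NumberField K] : Prop :=
  ¬ Algebra.IsUnramifiedIn (𝓞 K) (Ideal.span {(p : ℤ)})

/-! Let `α` enter the compositum at stage `k + 1`: it lies in `K E` but not in `K`, where `K` is the
compositum of `F 0, ..., F k` and `E = F (k + 1)`. Put `p = p (k + 1)`, `m = [E : ℚ]`, and work in a
Galois number field `L` containing `K E`. Some `σ` fixing `K` moves `α`, and the product formula is
applied to `α - σ α`.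

At a prime `P` of `L` above `p`, the inertia group `I` fixes `K` (unramified) and acts transitively
on the embeddings of `E` (total ramification). Hence `σ α = τ α` for some `τ ∈ I`, so `α - σ α`
vanishes modulo `P` when `α` is `P`-integral. Its stabilizer in `I` has index at most `m ^ 2`, which
bounds the ramification of the field it generates and gives `|α - σ α| ^ (m ^ 2) ≤ |p|` at `P`.
Multiplying over all places yields `p ≤ (2 * H(α) ^ 2) ^ (m ^ 2)`
(`pow_finrank_le_mulHeight₁_of_mem_sup`, `le_absMulHeight₁_of_mem_sup`).

As `m` is bounded and a prime can recur only after a stage with `F i = ℚ`, elements of bounded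
height enter at finitely many stages. They lie in one number field, where Northcott's theorem
applies. -/

open NumberField Height Pointwise
open scoped IntermediateField
open IsDedekindDomain

/-! ### Heights under extension of number fields -/

section Height

variable {K L : Type*} [Field K] [NumberField K] [Field L] [NumberField L]

lemma NumberField.InfinitePlace.prod_pow_mult_eq_prod_embeddings (h : InfinitePlace K → ℝ) :
    ∏ w : InfinitePlace K, h w ^ w.mult = ∏ φ : K →+* ℂ, h (.mk φ) := by
  classical
  rw [← Finset.prod_fiberwise Finset.univ (fun φ : K →+* ℂ ↦ InfinitePlace.mk φ)]
  refine Finset.prod_congr rfl fun w _ ↦ ?_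
  rw [← InfinitePlace.card_filter_mk_eq w, ← Finset.prod_const]
  exact Finset.prod_congr rfl fun φ hφ ↦ by rw [(Finset.mem_filter.mp hφ).2]

lemma NumberField.Embeddings.card_filter_comp_algebraMap_eq [Algebra K L] (ψ : K →+* ℂ)
    [DecidableEq (K →+* ℂ)] :
    (Finset.univ.filter fun φ : L →+* ℂ ↦ φ.comp (algebraMap K L) = ψ).card =
      Module.finrank K L := by
  let := ψ.toAlgebra
  rw [← AlgHom.card K L ℂ, ← Fintype.card_subtype]
  exact Fintype.card_congr
    { toFun := fun φ ↦ { φ.1 with commutes' := fun x ↦ RingHom.congr_fun φ.2 x }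
      invFun := fun φ ↦ ⟨φ.toRingHom, RingHom.ext fun x ↦ φ.commutes x⟩
      left_inv := fun _ ↦ rfl
      right_inv := fun _ ↦ rfl }

lemma NumberField.InfinitePlace.prod_comap_pow_mult [Algebra K L] (g : InfinitePlace K → ℝ) :
    ∏ w : InfinitePlace L, g (w.comap (algebraMap K L)) ^ w.mult =
      (∏ v : InfinitePlace K, g v ^ v.mult) ^ Module.finrank K L := by
  classical
  rw [prod_pow_mult_eq_prod_embeddings, prod_pow_mult_eq_prod_embeddings, ← Finset.prod_pow,
    ← Finset.prod_fiberwise Finset.univ (fun φ : L →+* ℂ ↦ φ.comp (algebraMap K L))]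
  refine Finset.prod_congr rfl fun ψ _ ↦ ?_
  rw [← Embeddings.card_filter_comp_algebraMap_eq ψ, ← Finset.prod_const]
  exact Finset.prod_congr rfl fun φ hφ ↦ by
    rw [InfinitePlace.comap_mk, (Finset.mem_filter.mp hφ).2]

/-- For `x = a / b` with `a`, `b` integral, the finite part of the height is the inverse norm of the
ideal `(a, b)`, so local degrees at finite places are avoided. The infinite part is a count of
embeddings. -/
lemma NumberField.mulHeight₁_algebraMap [Algebra K L] (x : K) :
    mulHeight₁ (algebraMap K L x) = mulHeight₁ x ^ Module.finrank K L := by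
  obtain ⟨a, b, hb, rfl⟩ := IsFractionRing.div_surjective (A := 𝓞 K) x
  have hb0 : b ≠ 0 := nonZeroDivisors.ne_zero hb
  have hK : ![a, b] ≠ 0 := by simp [hb0]
  have hL : ![algebraMap (𝓞 K) (𝓞 L) a, algebraMap (𝓞 K) (𝓞 L) b] ≠ 0 := by simp [hb0]
  have e1 := absNorm_mul_finprod_finitePlace_eq_one hK
  have e2 := absNorm_mul_finprod_finitePlace_eq_one hL
  have hI : Ideal.span (Set.range ![algebraMap (𝓞 K) (𝓞 L) a, algebraMap (𝓞 K) (𝓞 L) b]) =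
      (Ideal.span (Set.range ![a, b])).map (algebraMap (𝓞 K) (𝓞 L)) := by
    rw [Ideal.map_span]; congr 1; simp [Set.image_pair]
  rw [hI, Ideal.absNorm_algebraMap, Nat.cast_pow] at e2
  have hL' (i : Fin 2) : ((![algebraMap (𝓞 K) (𝓞 L) a, algebraMap (𝓞 K) (𝓞 L) b] i : 𝓞 L) : L) =
      ![algebraMap K L a, algebraMap K L b] i := by
    fin_cases i <;> rfl
  have hK' (i : Fin 2) : ((![a, b] i : 𝓞 K) : K) = ![(a : K), b] i := by fin_cases i <;> rfl
  simp only [hL'] at e2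
  simp only [hK'] at e1
  rw [map_div₀, mulHeight₁_div_eq_mulHeight, mulHeight₁_div_eq_mulHeight,
    mulHeight_eq (by simp [hb0]), mulHeight_eq (by simp [hb0]), mul_pow,
    ← InfinitePlace.prod_comap_pow_mult, IsFractionRing.finrank_eq (𝓞 K) K (𝓞 L) L,
    eq_inv_of_mul_eq_one_right e1, eq_inv_of_mul_eq_one_right e2, inv_pow]
  congr 1
  refine Finset.prod_congr rfl fun w _ ↦ ?_
  congr 1
  refine iSup_congr fun i ↦ ?_
  fin_cases i <;> rfl

lemma NumberField.mulHeight₁_map_pow (f : K →+* L) (x : K) :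
    mulHeight₁ (f x) ^ Module.finrank ℚ K = mulHeight₁ x ^ Module.finrank ℚ L := by
  let := f.toAlgebra
  rw [← RingHom.algebraMap_toAlgebra f, mulHeight₁_algebraMap, ← pow_mul, mul_comm,
    Module.finrank_mul_finrank]

lemma NumberField.absMulHeight₁_pow_finrank {M : Type*} [Field M] [CharZero M] (x : L)
    (f : L →+* M) :
    absMulHeight₁ (f x) ^ Module.finrank ℚ L = mulHeight₁ x := by
  have hx : IsIntegral ℚ (f x) := (IsIntegral.of_finite ℚ x).map f.toRatAlgHom
  have : FiniteDimensional ℚ ℚ⟮f x⟯ := IntermediateField.adjoin.finiteDimensional hx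
  have : NumberField ℚ⟮f x⟯ := {}
  have hle : ℚ⟮f x⟯ ≤ f.toRatAlgHom.fieldRange := by
    rw [IntermediateField.adjoin_simple_le_iff]
    exact ⟨x, rfl⟩
  let g : ℚ⟮f x⟯ →+* L := ((AlgEquiv.ofInjectiveField f.toRatAlgHom).symm.toAlgHom.comp
    (IntermediateField.inclusion hle)).toRingHom
  have hg : g (IntermediateField.AdjoinSimple.gen ℚ (f x)) = x := by
    apply f.injective
    exact congrArg Subtype.val ((AlgEquiv.ofInjectiveField f.toRatAlgHom).apply_symm_apply
      (IntermediateField.inclusion hle (IntermediateField.AdjoinSimple.gen ℚ (f x))))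
  have h := mulHeight₁_map_pow g (IntermediateField.AdjoinSimple.gen ℚ (f x))
  rw [hg] at h
  have hn : Module.finrank ℚ ℚ⟮f x⟯ ≠ 0 := Module.finrank_pos.ne'
  rw [absMulHeight₁, dif_pos hx]
  have hg0 := mulHeight₁_nonneg (IntermediateField.AdjoinSimple.gen ℚ (f x))
  rw [← pow_left_inj₀ (by positivity) (mulHeight₁_nonneg x) hn, h, ← pow_mul, mul_comm, pow_mul,
    Real.rpow_inv_natCast_pow (mulHeight₁_nonneg _) hn]

end Height

/-! ### Ramification indices of subfields via inertia groups -/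

section Inertia

lemma Ideal.card_inertia_eq_ramificationIdx {A B G : Type*} [CommRing A] [CommRing B]
    [IsDomain A] [IsDedekindDomain B] [Algebra A B] [Module.Finite A B] [Module.Flat A B]
    [Module.IsTorsionFree A B]
    [Ring.HasFiniteQuotients A] [Group G] [Finite G] [MulSemiringAction G B]
    [IsGaloisGroup G A B] (P : Ideal B) [P.IsPrime] (hP : P ≠ ⊥) :
    Nat.card (P.inertia G) = P.ramificationIdx A := by
  have : P.IsMaximal := Ring.DimensionLEOne.maximalOfPrime hP ‹_›
  have : (P.under A).IsMaximal := Ideal.IsMaximal.under A P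
  have : Finite (A ⧸ P.under A) :=
    Ring.HasFiniteQuotients.finiteQuotient (Ideal.under_ne_bot _ hP)
  rw [Ideal.card_inertia_eq_ramificationIdxIn (P.under A) P,
    Ideal.ramificationIdxIn_eq_ramificationIdx (P.under A) P G]

variable {L : Type*} [Field L] [NumberField L] [IsGalois ℚ L]

/-- With `I` the inertia group and `H` the group fixing `E`, `P` has ramification index `|I|` over
`ℤ` and `|I ∩ H|` over `𝓞 E`; multiplicativity in towers gives the quotient. -/
lemma NumberField.ramificationIdx_under_eq_relIndex (E : IntermediateField ℚ L)
    (P : Ideal (𝓞 L)) [P.IsPrime] (hP : P ≠ ⊥) :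
    (P.under (𝓞 E)).ramificationIdx ℤ =
      E.fixingSubgroup.relIndex (P.inertia Gal(L/ℚ)) := by
  have : IsGaloisGroup E.fixingSubgroup E L :=
    inferInstanceAs (IsGaloisGroup (fixingSubgroup Gal(L/ℚ) (E : Set L)) E L)
  have : IsGaloisGroup E.fixingSubgroup (𝓞 E) (𝓞 L) := .of_isFractionRing _ _ _ E L
  have h1 := P.card_inertia_eq_ramificationIdx (A := ℤ) (G := Gal(L/ℚ)) hP
  have h2 := P.card_inertia_eq_ramificationIdx (A := 𝓞 E) (G := E.fixingSubgroup) hP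
  have h3 : Nat.card (P.inertia E.fixingSubgroup) =
      Nat.card (P.inertia Gal(L/ℚ) ⊓ E.fixingSubgroup : Subgroup Gal(L/ℚ)) := by
    have := AddSubgroup.inertia_map_subtype P.toAddSubgroup E.fixingSubgroup
    rw [Ideal.inertia, Ideal.inertia, ← this]
    exact Nat.card_congr
      (Subgroup.equivMapOfInjective _ _ E.fixingSubgroup.subtype_injective).toEquiv
  have h4 := Ideal.ramificationIdx_tower (R := ℤ) (P.under (𝓞 E)) P
  have h5 := Subgroup.relIndex_mul_relIndex ⊥ (E.fixingSubgroup ⊓ P.inertia Gal(L/ℚ))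
    (P.inertia Gal(L/ℚ)) bot_le inf_le_right
  rw [Subgroup.relIndex_bot_left, Subgroup.relIndex_bot_left, Subgroup.inf_relIndex_right,
    inf_comm, ← h3, h2, h1, h4, mul_comm] at h5
  exact (Nat.eq_of_mul_eq_mul_right (Ideal.ramificationIdx_pos P _) h5).symm

end Inertia

/-! ### Valuations of elements with small inertia orbit -/

section Valuation

open WithZero

lemma NumberField.FinitePlace.apply_le_apply_iff {K : Type*} [Field K] [NumberField K]
    (w : FinitePlace K) (x y : K) :
    w x ≤ w y ↔ w.maximalIdeal.valuation K x ≤ w.maximalIdeal.valuation K y := by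
  rw [← w.norm_embedding_eq, ← w.norm_embedding_eq, FinitePlace.norm_embedding',
    FinitePlace.norm_embedding', NNReal.coe_le_coe]
  exact (WithZeroMulInt.toNNReal_strictMono
    (HeightOneSpectrum.one_lt_absNorm_nnreal w.maximalIdeal)).le_iff_le

lemma IsDedekindDomain.HeightOneSpectrum.valuation_sub_map_lt_one {R K G : Type*} [CommRing R]
    [IsDedekindDomain R] [Field K] [Algebra R K] [IsFractionRing R K] [Group G]
    [MulSemiringAction G R] [MulSemiringAction G K] [SMulDistribClass G R K]
    (v : HeightOneSpectrum R) {τ : G} (hτ : τ ∈ v.asIdeal.inertia G) {a : K}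
    (ha : v.valuation K a ≤ 1) : v.valuation K (a - τ • a) < 1 := by
  obtain ⟨x, s, h⟩ := v.exists_primeCompl_mul_eq_of_integer a ha
  have hs : (s : R) ∉ v.asIdeal := s.2
  have hτs : τ • (s : R) ∉ v.asIdeal := fun h' ↦
    hs (by simpa using sub_mem h' (hτ (s : R)))
  have h1 : v.valuation K (algebraMap R K s) = 1 := v.valuation_eq_one_iff_notMem.mpr hs
  have h2 : v.valuation K (algebraMap R K (τ • (s : R))) = 1 :=
    v.valuation_eq_one_iff_notMem.mpr hτs
  have hτ' : τ • a * algebraMap R K (τ • (s : R)) = algebraMap R K (τ • x) := by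
    rw [algebraMap.smul', algebraMap.smul', ← smul_mul', h]
  have key : (a - τ • a) * (algebraMap R K s * algebraMap R K (τ • (s : R))) =
      algebraMap R K (x * (τ • (s : R) - s) - (τ • x - x) * s) := by
    simp only [map_sub, map_mul, ← h, ← hτ']
    ring
  have : v.valuation K (algebraMap R K (x * (τ • (s : R) - s) - (τ • x - x) * s)) < 1 :=
    (v.valuation_lt_one_iff_mem _).mpr
    (sub_mem (Ideal.mul_mem_left _ _ (hτ _)) (Ideal.mul_mem_right _ _ (hτ _)))
  rwa [← key, map_mul, map_mul, h1, h2, mul_one, mul_one] at this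

lemma NumberField.valuation_pow_le_of_ramificationIdx_le {K : Type*} [Field K] [NumberField K]
    {p : ℕ} (hp : p.Prime) (v : HeightOneSpectrum (𝓞 K)) (hpv : (p : 𝓞 K) ∈ v.asIdeal)
    {D : ℕ} (hD : v.asIdeal.ramificationIdx ℤ ≤ D) {y : K} (hy : v.valuation K y < 1) :
    v.valuation K y ^ D ≤ v.valuation K (p : K) := by
  have hp0 : Ideal.span {(p : ℤ)} ≠ ⊥ := by simpa using hp.ne_zero
  let w : HeightOneSpectrum ℤ := ⟨Ideal.span {(p : ℤ)},
    (Ideal.span_singleton_prime (by simpa using hp.ne_zero)).mpr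
      (Nat.prime_iff_prime_int.mp hp), hp0⟩
  have : v.asIdeal.LiesOver w.asIdeal :=
    (Ideal.liesOver_span_iff v.isPrime.ne_top (Nat.prime_iff_prime_int.mp hp)).mpr
      (by simpa using hpv)
  have h := w.valuation_liesOver K v (p : ℚ)
  have hwp : w.valuation ℚ (p : ℚ) = exp (-1 : ℤ) := by
    have := w.valuation_of_algebraMap (K := ℚ) (p : ℤ)
    rw [w.intValuation_singleton (by simpa using hp.ne_zero) rfl] at this
    simpa using this
  rw [hwp, Ideal.ramificationIdx'_eq_ramificationIdx _ _ hp0, map_natCast] at h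
  rw [← h]
  -- The valuation is discrete, so below `1` means at most `exp (-1)`, while `p` has valuation `exp
  -- (-e)` with `e` the ramification index.
  have hy' : v.valuation K y ≤ exp (-1 : ℤ) := by
    rcases eq_or_ne (v.valuation K y) 0 with h0 | h0
    · simp [h0]
    · rw [← exp_log h0, exp_le_exp]
      rw [← exp_log h0, ← exp_zero, exp_lt_exp] at hy
      omega
  exact (pow_le_pow_right_of_le_one' hy.le hD).trans (pow_le_pow_left' hy' _)

lemma IntermediateField.fixingSubgroup_adjoin_simple {L : Type*} [Field L] [Algebra ℚ L]
    [FiniteDimensional ℚ L] (y : L) :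
    ℚ⟮y⟯.fixingSubgroup = MulAction.stabilizer Gal(L/ℚ) y := by
  refine le_antisymm (fun τ hτ ↦ ?_) ((IntermediateField.le_iff_le _ _).mp ?_)
  · exact hτ ⟨y, IntermediateField.mem_adjoin_simple_self ℚ y⟩
  · rw [IntermediateField.adjoin_simple_le_iff]
    exact fun τ ↦ τ.2

variable {L : Type*} [Field L] [NumberField L] [IsGalois ℚ L]

/-- The estimate is made in `ℚ⟮y⟯`, whose ramification index below `v` is the index of the
stabilizer of `y` in inertia, and then transported up to `L`. -/
lemma NumberField.valuation_pow_le_of_index_stabilizer_le {p : ℕ} (hp : p.Prime)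
    (v : HeightOneSpectrum (𝓞 L)) (hpv : (p : 𝓞 L) ∈ v.asIdeal) {y : L}
    (hy : v.valuation L y < 1) {D : ℕ}
    (hD : (MulAction.stabilizer (v.asIdeal.inertia Gal(L/ℚ)) y).index ≤ D) :
    v.valuation L y ^ D ≤ v.valuation L (p : L) := by
  let E := ℚ⟮y⟯
  let u : HeightOneSpectrum (𝓞 E) :=
    ⟨v.asIdeal.under (𝓞 E), inferInstance, Ideal.under_ne_bot _ v.ne_bot⟩
  have hu : v.asIdeal.LiesOver u.asIdeal :=
    inferInstanceAs (v.asIdeal.LiesOver (v.asIdeal.under (𝓞 E)))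
  have he : u.asIdeal.ramificationIdx ℤ ≤ D := by
    rw [NumberField.ramificationIdx_under_eq_relIndex E v.asIdeal v.ne_bot]
    refine le_of_eq_of_le ?_ hD
    rw [Subgroup.relIndex]
    rw [IntermediateField.fixingSubgroup_adjoin_simple]
    rfl
  have h (x : E) := u.valuation_liesOver L v x
  have h0 : u.asIdeal.ramificationIdx' v.asIdeal ≠ 0 :=
    Ideal.IsDedekindDomain.ramificationIdx'_ne_zero_of_liesOver v.asIdeal u.ne_bot
  have hyE := h (IntermediateField.AdjoinSimple.gen ℚ y)
  have hpE := h (p : E)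
  rw [IntermediateField.AdjoinSimple.algebraMap_gen] at hyE
  rw [map_natCast (algebraMap E L)] at hpE
  rw [← hyE, ← hpE, ← pow_mul, mul_comm, pow_mul]
  refine pow_le_pow_left' (NumberField.valuation_pow_le_of_ramificationIdx_le hp u ?_ he ?_) _
  · simpa [u] using hpv
  · rw [← hyE] at hy
    exact (pow_lt_one_iff h0).mp hy

end Valuation

/-- The `I`-orbit of the trivial coset in `G ⧸ H` has `H.relIndex I` elements, so the hypothesis
makes `I` transitive on `G ⧸ H`. -/
lemma Subgroup.exists_inv_mul_mem_of_relIndex_eq_index {G : Type*} [Group G] [Finite G]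
    {H I : Subgroup G} (h : H.relIndex I = H.index) (σ : G) : ∃ τ ∈ I, τ⁻¹ * σ ∈ H := by
  have hst : MulAction.stabilizer I ((1 : G) : G ⧸ H) = H.subgroupOf I := by
    ext τ
    rw [MulAction.mem_stabilizer_iff, Subgroup.mem_subgroupOf, eq_comm]
    change ((1 : G) : G ⧸ H) = ((τ * 1 : G) : G ⧸ H) ↔ _
    rw [QuotientGroup.eq, inv_one, one_mul, mul_one]
  have hcard := MulAction.index_stabilizer I ((1 : G) : G ⧸ H)
  rw [hst, ← Subgroup.relIndex, h, Subgroup.index, ← Set.ncard_univ] at hcard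
  have huniv := Set.eq_of_subset_of_ncard_le (Set.subset_univ _) hcard.le
  obtain ⟨τ, hτ⟩ : (σ : G ⧸ H) ∈ MulAction.orbit I ((1 : G) : G ⧸ H) := huniv ▸ Set.mem_univ _
  refine ⟨τ, τ.2, ?_⟩
  rw [← QuotientGroup.eq, ← hτ]
  exact congrArg _ (mul_one (τ : G)).symm

/-! ### Local bounds at finite places -/

section LocalBound

variable {L : Type*} [Field L] [NumberField L] [IsGalois ℚ L]

lemma NumberField.FinitePlace.apply_sub_pow_le {p : ℕ} (hp : p.Prime)
    (w : FinitePlace L) (hpw : (p : 𝓞 L) ∈ w.maximalIdeal.asIdeal) {m : ℕ} {a : L}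
    {τ : Gal(L/ℚ)} (hτ : τ ∈ w.maximalIdeal.asIdeal.inertia Gal(L/ℚ))
    (hm : (MulAction.stabilizer (w.maximalIdeal.asIdeal.inertia Gal(L/ℚ)) a).index ≤ m)
    (ha : w a ≤ 1) : w (a - τ a) ^ (m * m) ≤ w (p : L) := by
  set I := w.maximalIdeal.asIdeal.inertia Gal(L/ℚ)
  rw [← map_one w, w.apply_le_apply_iff, map_one] at ha
  rw [← map_pow, w.apply_le_apply_iff, map_pow]
  refine valuation_pow_le_of_index_stabilizer_le hp _ hpw
    (w.maximalIdeal.valuation_sub_map_lt_one hτ ha) ?_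
  have hidx : (MulAction.stabilizer I (τ a)).index = (MulAction.stabilizer I a).index := by
    rw [MulAction.index_stabilizer, MulAction.index_stabilizer]
    congr 1
    exact MulAction.orbit_smul (⟨τ, hτ⟩ : I) a
  -- Both stabilizers have index at most `m`, so their intersection has index at most `m * m`: the
  -- source of the exponent.
  have hle : MulAction.stabilizer I a ⊓ MulAction.stabilizer I (τ a) ≤
      MulAction.stabilizer I (a - τ a) := by
    rintro g ⟨h1, h2⟩
    rw [MulAction.mem_stabilizer_iff, smul_sub]
    exact congrArg₂ _ h1 h2
  calc _ ≤ (MulAction.stabilizer I a ⊓ MulAction.stabilizer I (τ a)).index :=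
        Subgroup.index_antitone hle
    _ ≤ _ := Subgroup.index_inf_le
    _ ≤ m * m := Nat.mul_le_mul hm (hidx ▸ hm)

lemma NumberField.FinitePlace.apply_sub_pow_le_mul_max {p : ℕ} (hp : p.Prime)
    (w : FinitePlace L) (hpw : (p : 𝓞 L) ∈ w.maximalIdeal.asIdeal) {m : ℕ} {a : L}
    {τ : Gal(L/ℚ)} (hτ : τ ∈ w.maximalIdeal.asIdeal.inertia Gal(L/ℚ))
    (hm : (MulAction.stabilizer (w.maximalIdeal.asIdeal.inertia Gal(L/ℚ)) a).index ≤ m) :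
    w (a - τ a) ^ (m * m) ≤ w (p : L) * (max (w a) 1 * max (w (τ a)) 1) ^ (m * m) := by
  rcases le_or_gt (w a) 1 with ha | ha
  · refine (w.apply_sub_pow_le hp hpw hτ hm ha).trans (le_mul_of_one_le_right (apply_nonneg w _) ?_)
    exact one_le_pow₀ (one_le_mul_of_one_le_of_one_le (le_max_right _ _) (le_max_right _ _))
  · have ha0 : a ≠ 0 := by rintro rfl; simp at ha; linarith
    have hτ0 : τ a ≠ 0 := by simpa using ha0
    have hm' : (MulAction.stabilizer (w.maximalIdeal.asIdeal.inertia Gal(L/ℚ)) a⁻¹).index ≤ m := by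
      convert hm using 2
      ext g
      rw [MulAction.mem_stabilizer_iff, MulAction.mem_stabilizer_iff, smul_inv'', inv_inj]
    have h := w.apply_sub_pow_le hp hpw hτ hm' (by rw [map_inv₀]; exact inv_le_one_of_one_le₀ ha.le)
    -- When `a` is not integral at `w`, its inverse is; the factor `a * τ a` is absorbed by the
    -- maxima.
    have e : a - τ a = (a⁻¹ - τ a⁻¹) * (- (a * τ a)) := by
      rw [map_inv₀]; field_simp; ring
    rw [e, map_mul, mul_pow, map_neg_eq_map, map_mul]
    gcongr
    · exact le_max_left _ _
    · exact le_max_left _ _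

lemma NumberField.FinitePlace.apply_sub_le_max_mul_max {K : Type*} [Field K] [NumberField K]
    (w : FinitePlace K) (a b : K) : w (a - b) ≤ max (w a) 1 * max (w b) 1 := by
  have h := w.add_le a (-b)
  rw [← sub_eq_add_neg, map_neg_eq_map] at h
  refine h.trans (max_le ?_ ?_)
  · exact (le_max_left _ _).trans (le_mul_of_one_le_right (by positivity) (le_max_right _ _))
  · exact (le_max_left _ _).trans (le_mul_of_one_le_left (by positivity) (le_max_right _ _))

end LocalBound

/-! ### Product formula: from local bounds to heights -/

section HeightBound

lemma NumberField.InfinitePlace.apply_sub_le_two_mul {K : Type*} [Field K] [NumberField K]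
    (w : InfinitePlace K) (a b : K) : w (a - b) ≤ 2 * (max (w a) 1 * max (w b) 1) := by
  have h : w (a - b) ≤ w a + w b := by
    simpa only [← InfinitePlace.norm_embedding_eq, map_sub] using norm_sub_le _ _
  have h1 : w a ≤ max (w a) 1 * max (w b) 1 :=
    (le_max_left _ _).trans (le_mul_of_one_le_right (by positivity) (le_max_right _ _))
  have h2 : w b ≤ max (w a) 1 * max (w b) 1 :=
    (le_max_left _ _).trans (le_mul_of_one_le_left (by positivity) (le_max_right _ _))
  linarith

lemma NumberField.FinitePlace.hasFiniteMulSupport_max_one {K : Type*} [Field K] [NumberField K]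
    (a : K) : (fun w : FinitePlace K ↦ max (w a) 1).HasFiniteMulSupport := by
  rcases eq_or_ne a 0 with rfl | ha
  · simp [Function.HasFiniteMulSupport]
  · exact (FinitePlace.hasFiniteMulSupport ha).subset fun w hw h ↦ hw (by simp [h])

/-- The product formula is used twice: for `a - b`, and for `n`, whose finite absolute values
multiply to `n ^ (-[K : ℚ])`. The factor `2` comes from the archimedean triangle inequality. -/
lemma NumberField.pow_finrank_le_mulHeight₁_mul {K : Type*} [Field K] [NumberField K] {n : ℕ}
    (hn : n ≠ 0) {a b : K} (hab : a ≠ b) {D : ℕ}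
    (h : ∀ w : FinitePlace K, w (a - b) ^ D ≤ w (n : K) * (max (w a) 1 * max (w b) 1) ^ D) :
    (n : ℝ) ^ Module.finrank ℚ K ≤
      (2 ^ Module.finrank ℚ K * (mulHeight₁ a * mulHeight₁ b)) ^ D := by
  have hy : a - b ≠ 0 := sub_ne_zero.mpr hab
  have hn' : (n : K) ≠ 0 := by exact_mod_cast hn
  have hN : ∏ w : InfinitePlace K, w (n : K) ^ w.mult = (n : ℝ) ^ Module.finrank ℚ K := by
    simp [InfinitePlace.sum_mult_eq, Finset.prod_pow_eq_pow_sum]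
  have hfn := prod_abs_eq_one hn'
  have hprod := prod_abs_eq_one hy
  have hinf : ∏ w : InfinitePlace K, w (a - b) ^ w.mult ≤ 2 ^ Module.finrank ℚ K *
      ((∏ w : InfinitePlace K, max (w a) 1 ^ w.mult) *
        ∏ w : InfinitePlace K, max (w b) 1 ^ w.mult) := by
    rw [← InfinitePlace.sum_mult_eq, ← Finset.prod_pow_eq_pow_sum, ← Finset.prod_mul_distrib,
      ← Finset.prod_mul_distrib]
    refine Finset.prod_le_prod (fun w _ ↦ by positivity) fun w _ ↦ ?_
    rw [← mul_pow, ← mul_pow]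
    exact pow_le_pow_left₀ (apply_nonneg w _) (w.apply_sub_le_two_mul a b) _
  have hfin : (∏ᶠ w : FinitePlace K, w (a - b)) ^ D ≤ (∏ᶠ w : FinitePlace K, w (n : K)) *
      ((∏ᶠ w : FinitePlace K, max (w a) 1) * ∏ᶠ w : FinitePlace K, max (w b) 1) ^ D := by
    have hs := FinitePlace.hasFiniteMulSupport hy
    have hns := FinitePlace.hasFiniteMulSupport hn'
    have has := FinitePlace.hasFiniteMulSupport_max_one a
    have hbs := FinitePlace.hasFiniteMulSupport_max_one b
    rw [finprod_pow hs, ← finprod_mul_distrib has hbs, finprod_pow (by fun_prop),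
      ← finprod_mul_distrib hns (by fun_prop)]
    exact finprod_le_finprod (by fun_prop) (fun w ↦ by positivity) (by fun_prop) h
  rw [hN] at hfn
  rw [mulHeight₁_eq, mulHeight₁_eq]
  set A := ∏ w : InfinitePlace K, w (a - b) ^ w.mult
  set B := ∏ᶠ w : FinitePlace K, w (a - b)
  set C := ∏ᶠ w : FinitePlace K, w (n : K)
  have hA : 0 ≤ A := Finset.prod_nonneg fun w _ ↦ by positivity
  have hB : 0 ≤ B := finprod_nonneg fun w ↦ apply_nonneg w _
  have hnp : (0 : ℝ) < (n : ℝ) ^ Module.finrank ℚ K := by positivity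
  set M := (∏ᶠ w : FinitePlace K, max (w a) 1) * ∏ᶠ w : FinitePlace K, max (w b) 1
  calc (n : ℝ) ^ Module.finrank ℚ K = (n : ℝ) ^ Module.finrank ℚ K * (A ^ D * B ^ D) := by
        rw [← mul_pow, hprod, one_pow, mul_one]
    _ ≤ (n : ℝ) ^ Module.finrank ℚ K * ((2 ^ Module.finrank ℚ K *
        ((∏ w : InfinitePlace K, max (w a) 1 ^ w.mult) *
          ∏ w : InfinitePlace K, max (w b) 1 ^ w.mult)) ^ D * (C * M ^ D)) := by gcongr
    _ = ((n : ℝ) ^ Module.finrank ℚ K * C) * (2 ^ Module.finrank ℚ K *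
        ((∏ w : InfinitePlace K, max (w a) 1 ^ w.mult) *
          ∏ w : InfinitePlace K, max (w b) 1 ^ w.mult) * M) ^ D := by rw [mul_pow _ M]; ring
    _ = _ := by rw [hfn, one_mul]; congr 1; simp only [M]; ring

end HeightBound

/-! ### Lower height bound inside a Galois field -/

section CompositumBound

variable {L : Type*} [Field L] [NumberField L] [IsGalois ℚ L]

theorem NumberField.pow_finrank_le_mulHeight₁_of_mem_sup {p : ℕ} (hp : p.Prime)
    (K E : IntermediateField ℚ L)
    (hK : ∀ P : Ideal (𝓞 L), P.IsPrime → (p : 𝓞 L) ∈ P → P.inertia Gal(L/ℚ) ≤ K.fixingSubgroup)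
    (hE : ∀ P : Ideal (𝓞 L), P.IsPrime → (p : 𝓞 L) ∈ P →
      E.fixingSubgroup.relIndex (P.inertia Gal(L/ℚ)) = Module.finrank ℚ E)
    {a : L} (ha : a ∈ K ⊔ E) (haK : a ∉ K) :
    (p : ℝ) ^ Module.finrank ℚ L ≤
      (2 ^ Module.finrank ℚ L * (mulHeight₁ a * mulHeight₁ a)) ^
        (Module.finrank ℚ E * Module.finrank ℚ E) := by
  obtain ⟨σ, hσ, hσa⟩ : ∃ σ ∈ K.fixingSubgroup, a ≠ σ a := by
    by_contra! h
    apply haK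
    rw [← IsGalois.fixedField_fixingSubgroup K]
    exact fun σ ↦ (h σ σ.2).symm
  have hht : mulHeight₁ (σ a) = mulHeight₁ a := by
    have := mulHeight₁_map_pow (σ : L →+* L) a
    exact (pow_left_inj₀ (mulHeight₁_nonneg _) (mulHeight₁_nonneg _) Module.finrank_pos.ne').mp this
  have key := pow_finrank_le_mulHeight₁_mul hp.ne_zero hσa
    (D := Module.finrank ℚ E * Module.finrank ℚ E) fun w ↦ ?_
  · rwa [hht] at key
  by_cases hpw : (p : 𝓞 L) ∈ w.maximalIdeal.asIdeal
  · have hI := hK _ w.maximalIdeal.isPrime hpw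
    have hidx := hE _ w.maximalIdeal.isPrime hpw
    -- `σ` is the same for all places, as the product formula requires, but `τ` depends on `w`.
    obtain ⟨τ, hτ, hτσ⟩ := Subgroup.exists_inv_mul_mem_of_relIndex_eq_index
      (hidx.trans (IntermediateField.finrank_eq_fixingSubgroup_index _ E)) σ
    have hfix {g : Gal(L/ℚ)} (h1 : g ∈ K.fixingSubgroup) (h2 : g ∈ E.fixingSubgroup) : g a = a := by
      have : g ∈ (K ⊔ E).fixingSubgroup := by
        rw [IntermediateField.fixingSubgroup_sup]; exact ⟨h1, h2⟩
      exact this ⟨a, ha⟩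
    have hστ : σ a = τ a := by
      have := hfix (mul_mem (inv_mem (hI hτ)) hσ) hτσ
      rw [AlgEquiv.mul_apply] at this
      simpa using congrArg τ this
    rw [hστ]
    refine w.apply_sub_pow_le_mul_max hp hpw hτ ?_
    rw [← hidx]
    -- Inertia already fixes `K`, so an element of it that fixes `E` fixes `a`.
    refine Subgroup.index_antitone fun g hg ↦ ?_
    exact hfix (hI g.2) hg
  · have h1 : w (p : L) = 1 := by
      rw [← w.norm_embedding_eq, ← map_natCast (algebraMap (𝓞 L) L)]
      exact (FinitePlace.norm_eq_one_iff_notMem L _ (p : 𝓞 L)).mpr hpw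
    rw [h1, one_mul]
    exact pow_le_pow_left₀ (apply_nonneg w _) (w.apply_sub_le_max_mul_max _ _) _

end CompositumBound

lemma NumberField.absMulHeight₁_nonneg {K : Type*} [Field K] [CharZero K] (x : K) :
    0 ≤ absMulHeight₁ x := by
  rw [absMulHeight₁]
  split_ifs with hx
  · have : FiniteDimensional ℚ ℚ⟮x⟯ := IntermediateField.adjoin.finiteDimensional hx
    have : NumberField ℚ⟮x⟯ := {}
    exact Real.rpow_nonneg (mulHeight₁_nonneg _) _
  · exact zero_le_one

/-! ### Total ramification, unramifiedness, and their invariance -/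

section Ramification

lemma NumberField.finrank_eq_of_ringEquiv {K K' : Type*} [Field K] [CharZero K] [Field K']
    [CharZero K'] (e : K ≃+* K') : Module.finrank ℚ K = Module.finrank ℚ K' :=
  (AlgEquiv.ofRingEquiv (f := e) fun r ↦ by simp).toLinearEquiv.finrank_eq

lemma NumberField.liesOver_span_of_mem {K : Type*} [Field K] {p : ℕ} (hp : p.Prime)
    {P : Ideal (𝓞 K)} [hP : P.IsPrime]
    (hpP : (p : 𝓞 K) ∈ P) : P.LiesOver (Ideal.span {(p : ℤ)}) :=
  (Ideal.liesOver_span_iff hP.ne_top (Nat.prime_iff_prime_int.mp hp)).mpr (by simpa using hpP)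

variable {K : Type*} [Field K] [NumberField K] {p : ℕ}

lemma ramificationIdx_eq_one_of_not_ramifiesIn (hp : p.Prime) (h : ¬ RamifiesIn p K)
    {P : Ideal (𝓞 K)} [P.IsPrime] (hpP : (p : 𝓞 K) ∈ P) : P.ramificationIdx ℤ = 1 :=
  (not_not.mp h).ramificationIdx_eq_one (liesOver_span_of_mem hp hpP)

lemma RamifiesTotallyIn.ramificationIdx_eq (hp : p.Prime) (h : RamifiesTotallyIn p K)
    {P : Ideal (𝓞 K)} [hP : P.IsPrime] (hpP : (p : 𝓞 K) ∈ P) :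
    P.ramificationIdx ℤ = Module.finrank ℚ K := by
  obtain ⟨Q, hQ, h⟩ := h
  have hp0 : (p : 𝓞 K) ≠ 0 := by exact_mod_cast hp.ne_zero
  have hQ0 : Q ≠ ⊥ := by
    rintro rfl
    rw [Ideal.bot_pow Module.finrank_pos.ne', Ideal.span_singleton_eq_bot] at h
    exact hp0 h
  have hQP : Q ≤ P := hP.le_of_pow_le (h ▸ (Ideal.span_singleton_le_iff_mem _).mpr hpP)
  obtain rfl : Q = P := (hQ.isMaximal hQ0).eq_of_le hP.ne_top hQP
  have := liesOver_span_of_mem hp hpP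
  have hmap : (Ideal.span {(p : ℤ)}).map (algebraMap ℤ (𝓞 K)) = Q ^ Module.finrank ℚ K := by
    rw [Ideal.map_span, Set.image_singleton, ← h]
    simp
  rw [Ideal.IsDedekindDomain.ramificationIdx_eq_multiplicity (Ideal.span {(p : ℤ)}) Q
    (hmap ▸ pow_ne_zero _ hQ0), hmap]
  exact multiplicity_pow_self hQ0 (fun h ↦ hQ.ne_top (Ideal.isUnit_iff.mp h)) _

/-- This controls repetitions in the sequence of primes: `p i = p j` with `1 ≤ i < j` forces `F i =
ℚ`. -/
lemma RamifiesTotallyIn.finrank_eq_one (hp : p.Prime) (h : RamifiesTotallyIn p K)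
    (h' : ¬ RamifiesIn p K) : Module.finrank ℚ K = 1 := by
  obtain ⟨Q, hQ, hQp⟩ := id h
  have hpQ : (p : 𝓞 K) ∈ Q := Ideal.pow_le_self Module.finrank_pos.ne'
    (hQp ▸ Ideal.mem_span_singleton_self _)
  rw [← h.ramificationIdx_eq hp hpQ, ramificationIdx_eq_one_of_not_ramifiesIn hp h' hpQ]

variable {K' : Type*} [Field K'] [NumberField K']

lemma RamifiesTotallyIn.of_ringEquiv (e : K ≃+* K') (h : RamifiesTotallyIn p K) :
    RamifiesTotallyIn p K' := by
  obtain ⟨Q, hQ, h⟩ := h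
  let f : 𝓞 K ≃+* 𝓞 K' := RingOfIntegers.mapRingEquiv e
  refine ⟨Q.map f, Ideal.map_isPrime_of_equiv f, ?_⟩
  rw [← Ideal.map_pow, ← finrank_eq_of_ringEquiv e, ← h, Ideal.map_span, Set.image_singleton,
    map_natCast]

lemma not_ramifiesIn_of_ringEquiv (hp : p.Prime) (e : K ≃+* K') (h : ¬ RamifiesIn p K) :
    ¬ RamifiesIn p K' := by
  have hp' := Nat.prime_iff_prime_int.mp hp
  rw [RamifiesIn, not_not, ← not_dvd_discr_iff_isUnramifiedIn K _ hp'] at h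
  rw [RamifiesIn, not_not, ← not_dvd_discr_iff_isUnramifiedIn K' _ hp']
  rwa [← discr_eq_discr_of_ringEquiv K e]

end Ramification

/-! ### Ramification hypotheses in terms of inertia -/

section Inertia

variable {L : Type*} [Field L] [NumberField L] [IsGalois ℚ L] {p : ℕ}

lemma inertia_le_fixingSubgroup_of_not_ramifiesIn (hp : p.Prime) {E : IntermediateField ℚ L}
    (h : ¬ RamifiesIn p E) {P : Ideal (𝓞 L)} [P.IsPrime] (hpP : (p : 𝓞 L) ∈ P) :
    P.inertia Gal(L/ℚ) ≤ E.fixingSubgroup := by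
  have hP : P ≠ ⊥ := by
    rintro rfl
    exact hp.ne_zero (by exact_mod_cast (Ideal.mem_bot.mp hpP))
  rw [← Subgroup.relIndex_eq_one, ← ramificationIdx_under_eq_relIndex E P hP]
  exact ramificationIdx_eq_one_of_not_ramifiesIn hp h (by simpa using hpP)

lemma RamifiesTotallyIn.relIndex_eq (hp : p.Prime) {E : IntermediateField ℚ L}
    (h : RamifiesTotallyIn p E) {P : Ideal (𝓞 L)} [P.IsPrime] (hpP : (p : 𝓞 L) ∈ P) :
    E.fixingSubgroup.relIndex (P.inertia Gal(L/ℚ)) = Module.finrank ℚ E := by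
  have hP : P ≠ ⊥ := by
    rintro rfl
    exact hp.ne_zero (by exact_mod_cast (Ideal.mem_bot.mp hpP))
  rw [← ramificationIdx_under_eq_relIndex E P hP]
  exact h.ramificationIdx_eq hp (by simpa using hpP)

end Inertia

/-! ### Transfer to subfields of an algebraic closure -/

section Compositum

universe u

lemma IntermediateField.finiteDimensional_partialSups {k A : Type*} [Field k] [Field A]
    [Algebra k A] (F : ℕ → IntermediateField k A) [∀ i, FiniteDimensional k (F i)] (n : ℕ) :
    FiniteDimensional k (partialSups F n : IntermediateField k A) := by
  induction n with
  | zero => rw [partialSups_zero]; infer_instance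
  | succ n ih =>
    rw [partialSups_add_one]
    infer_instance

variable {A : Type*} [Field A] [CharZero A]

lemma NumberField.finite_setOf_mem_and_absMulHeight₁_le (K : IntermediateField ℚ A)
    [FiniteDimensional ℚ K] (X : ℝ) : {α | α ∈ K ∧ absMulHeight₁ α ≤ X}.Finite := by
  have : NumberField K := ⟨⟩
  refine ((finite_setOfPred_mulHeight₁_le K (X ^ Module.finrank ℚ K)).image
    (algebraMap K A)).subset ?_
  rintro α ⟨hα, hX⟩
  refine ⟨⟨α, hα⟩, ?_, rfl⟩
  change mulHeight₁ _ ≤ _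
  rw [← absMulHeight₁_pow_finrank _ (algebraMap K A)]
  exact pow_le_pow_left₀ (absMulHeight₁_nonneg α) hX _

/-- A subfield of `A` contained in the range of `f` is isomorphic to its preimage. -/
noncomputable def IntermediateField.comapRingEquiv {L : Type*} [Field L] [Algebra ℚ L]
    (f : L →ₐ[ℚ] A) (F : IntermediateField ℚ A) (hF : F ≤ f.fieldRange) : F ≃+* F.comap f :=
  RingEquiv.symm <| RingEquiv.ofBijective
    ((f.toRingHom.comp (algebraMap (F.comap f) L)).codRestrict F fun x ↦ x.2)
    ⟨RingHom.injective _, fun y ↦ by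
      obtain ⟨x, hx⟩ := hF y.2
      exact ⟨⟨x, (show f x ∈ F from hx ▸ y.2)⟩, Subtype.ext hx⟩⟩

lemma IntermediateField.map_comap_of_le_fieldRange {L : Type*} [Field L] [Algebra ℚ L]
    (f : L →ₐ[ℚ] A) {F : IntermediateField ℚ A} (hF : F ≤ f.fieldRange) :
    (F.comap f).map f = F := by
  refine le_antisymm ((gc_map_comap f).l_u_le F) fun y hy ↦ ?_
  obtain ⟨x, rfl⟩ := hF hy
  exact ⟨x, hy, rfl⟩

theorem le_absMulHeight₁_of_mem_sup {L : Type*} [Field L] [NumberField L] [IsGalois ℚ L]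
    (f : L →ₐ[ℚ] A) {ι : Type*} (F : ι → IntermediateField ℚ A) [∀ i, NumberField (F i)]
    (E : IntermediateField ℚ A) [NumberField E] {p : ℕ} (hp : p.Prime)
    (htot : RamifiesTotallyIn p E) (hunram : ∀ i, ¬ RamifiesIn p (F i))
    (hFL : ∀ i, F i ≤ f.fieldRange) (hEL : E ≤ f.fieldRange) {α : A}
    (hα : α ∈ (⨆ i, F i) ⊔ E) (hα' : α ∉ ⨆ i, F i) :
    (p : ℝ) ≤ (2 * absMulHeight₁ α ^ 2) ^ (Module.finrank ℚ E * Module.finrank ℚ E) := by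
  have hE := htot.of_ringEquiv (E.comapRingEquiv f hEL)
  have hfin := finrank_eq_of_ringEquiv (E.comapRingEquiv f hEL)
  have hmap : ((⨆ i, (F i).comap f) ⊔ E.comap f).map f = (⨆ i, F i) ⊔ E := by
    simp only [IntermediateField.map_sup, IntermediateField.map_iSup,
      IntermediateField.map_comap_of_le_fieldRange f (hFL _),
      IntermediateField.map_comap_of_le_fieldRange f hEL]
  rw [← hmap] at hα
  obtain ⟨a, ha, rfl⟩ := hα
  have haK : a ∉ ⨆ i, (F i).comap f := fun h ↦ hα' <| by
    have : f a ∈ (⨆ i, (F i).comap f).map f := ⟨a, h, rfl⟩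
    simp only [IntermediateField.map_iSup,
      IntermediateField.map_comap_of_le_fieldRange f (hFL _)] at this
    exact this
  have key := pow_finrank_le_mulHeight₁_of_mem_sup hp (⨆ i, (F i).comap f) (E.comap f)
    (fun P _ hpP ↦ ?_) (fun P _ hpP ↦ hE.relIndex_eq hp hpP) ha haK
  · have hh : mulHeight₁ a = absMulHeight₁ (f a) ^ Module.finrank ℚ L :=
      (absMulHeight₁_pow_finrank a (f : L →+* A)).symm
    rw [← hfin, hh, ← mul_pow, ← mul_pow, ← sq] at key
    rw [pow_right_comm] at key
    have := absMulHeight₁_nonneg (f a)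
    exact le_of_pow_le_pow_left₀ Module.finrank_pos.ne' (by positivity) key
  · rw [← IntermediateField.le_iff_le, iSup_le_iff]
    intro i
    rw [IntermediateField.le_iff_le]
    exact inertia_le_fixingSubgroup_of_not_ramifiesIn hp
      (not_ramifiesIn_of_ringEquiv hp ((F i).comapRingEquiv f (hFL i)) (hunram i)) hpP

lemma NumberField.exists_isGalois_le_fieldRange {A : Type u} [Field A] [CharZero A]
    [IsAlgClosed A] [Algebra.IsAlgebraic ℚ A] (K : IntermediateField ℚ A)
    [FiniteDimensional ℚ K] :
    ∃ (L : Type u) (_ : Field L) (_ : NumberField L) (_ : IsGalois ℚ L) (f : L →ₐ[ℚ] A),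
      K ≤ f.fieldRange := by
  have : IsAlgClosure ℚ A := ⟨inferInstance, inferInstance⟩
  have : Normal ℚ A := IsAlgClosure.normal ℚ A
  let L : IntermediateField ℚ A := IntermediateField.normalClosure ℚ K A
  have : NumberField L := ⟨⟩
  have : Normal ℚ L := normalClosure.normal ..
  refine ⟨L, inferInstance, inferInstance, ⟨⟩, (algebraMap L A).toRatAlgHom, fun x hx ↦ ?_⟩
  exact ⟨⟨x, K.le_normalClosure hx⟩, rfl⟩

/-- `hunram` asks only that each `F j` lie in some unramified `F i`, because for `F 0`
unramifiedness is available only through `F 1`. -/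
theorem le_absMulHeight₁_of_mem_partialSups [IsAlgClosed A] [Algebra.IsAlgebraic ℚ A]
    (F : ℕ → IntermediateField ℚ A) [∀ i, NumberField (F i)]
    {p k : ℕ} (hp : p.Prime) (htot : RamifiesTotallyIn p (F (k + 1)))
    (hunram : ∀ j ≤ k, ∃ i ≤ k, F j ≤ F i ∧ ¬ RamifiesIn p (F i)) {α : A}
    (hα : α ∈ partialSups F (k + 1)) (hα' : α ∉ partialSups F k) :
    (p : ℝ) ≤ (2 * absMulHeight₁ α ^ 2) ^
      (Module.finrank ℚ (F (k + 1)) * Module.finrank ℚ (F (k + 1))) := by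
  have := IntermediateField.finiteDimensional_partialSups F (k + 1)
  obtain ⟨L, _, _, _, f, hf⟩ := exists_isGalois_le_fieldRange (partialSups F (k + 1))
  have hFL (j : ℕ) (hj : j ≤ k + 1) : F j ≤ f.fieldRange := (le_partialSups_of_le F hj).trans hf
  let F' : {i // i ≤ k ∧ ¬ RamifiesIn p (F i)} → IntermediateField ℚ A := fun i ↦ F i
  have (i : _) : NumberField (F' i) := inferInstanceAs (NumberField (F i))
  have hF' : ⨆ i, F' i = partialSups F k := by
    refine le_antisymm (iSup_le fun i ↦ le_partialSups_of_le F i.2.1)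
      (partialSups_le _ _ _ fun j hj ↦ ?_)
    obtain ⟨i, hi, hle, hun⟩ := hunram j hj
    exact hle.trans (le_iSup F' ⟨i, hi, hun⟩)
  rw [partialSups_add_one, ← hF'] at hα
  rw [← hF'] at hα'
  exact le_absMulHeight₁_of_mem_sup f F' (F (k + 1)) hp htot (fun i ↦ i.2.2)
    (fun i ↦ hFL i (i.2.1.trans k.le_succ)) (hFL _ le_rfl) hα hα'

end Compositum

/-! ### The Northcott property -/

theorem corollary1p7 (d : ℕ) (hd : 0 < d)
    (F : ℕ → IntermediateField ℚ (AlgebraicClosure ℚ))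
    [∀ i, NumberField (F i)]
    (hF : ∀ i, 1 ≤ i → F 0 ≤ F i)
    (hdeg : ∀ i, 1 ≤ i → IntermediateField.relfinrank (F 0) (F i) ≤ d)
    (p : ℕ → ℕ) (hp : ∀ i, 1 ≤ i → (p i).Prime)
    (htot : ∀ i, 1 ≤ i → RamifiesTotallyIn (p i) (F i))
    (hunram : ∀ i j, 1 ≤ j → j < i → ¬ RamifiesIn (p i) (F j)) :
    HasNorthcottProperty ((⨆ i, F i : IntermediateField ℚ (AlgebraicClosure ℚ)) :
      Set (AlgebraicClosure ℚ)) := by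
  intro X hX
  have : Algebra.IsAlgebraic ℚ (AlgebraicClosure ℚ) := by
    convert! AlgebraicClosure.isAlgebraic ℚ
  have hdim (i : ℕ) (hi : 1 ≤ i) : Module.finrank ℚ (F i) ≤ Module.finrank ℚ (F 0) * d := by
    have h := IntermediateField.relfinrank_mul_relfinrank (bot_le (a := F 0)) (hF i hi)
    rw [IntermediateField.relfinrank_bot_left, IntermediateField.relfinrank_bot_left] at h
    exact h ▸ Nat.mul_le_mul_left _ (hdeg i hi)
  set m := Module.finrank ℚ (F 0) * d
  -- The maximum with `1` ensures `1 ≤ Y`, so that exponents can be enlarged to `m * m`.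
  set Y := 2 * max X 1 ^ 2
  have hY : 1 ≤ Y := by
    have : 1 ≤ max X 1 ^ 2 := one_le_pow₀ (le_max_right X 1)
    linarith
  -- On indices with `F i ≠ ⊥` the map `p` is injective; trivial fields may repeat primes but
  -- contribute nothing to the compositum.
  have hfin : {i | 1 ≤ i ∧ F i ≠ ⊥ ∧ (p i : ℝ) ≤ Y ^ (m * m)}.Finite := by
    refine Set.Finite.of_finite_image (f := p)
      ((Set.finite_le_nat ⌊Y ^ (m * m)⌋₊).subset ?_) fun i hi j hj hij ↦ ?_
    · rintro _ ⟨i, hi, rfl⟩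
      exact Nat.le_floor hi.2.2
    · have key {i j : ℕ} (hi : 1 ≤ i) (hb : F i ≠ ⊥) (hpij : p i = p j) (hlt : i < j) : False :=
        hb (IntermediateField.finrank_eq_one_iff.mp
          ((htot i hi).finrank_eq_one (hp i hi) (hpij ▸ hunram j i hi hlt)))
      rcases lt_trichotomy i j with hlt | h | hlt
      · exact (key hi.1 hi.2.1 hij hlt).elim
      · exact h
      · exact (key hj.1 hj.2.1 hij.symm hlt).elim
  obtain ⟨N, hN⟩ := hfin.bddAbove
  have := IntermediateField.finiteDimensional_partialSups F (N + 1)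
  refine (finite_setOf_mem_and_absMulHeight₁_le (partialSups F (N + 1)) X).subset ?_
  rintro α ⟨hα, hαX⟩
  refine ⟨?_, hαX⟩
  by_contra hαN
  have hex : ∃ n, α ∈ partialSups F n := by
    rw [← iSup_partialSups_eq, SetLike.mem_coe, ← SetLike.mem_coe,
      IntermediateField.coe_iSup_of_directed (partialSups F).mono.directed_le, Set.mem_iUnion] at hα
    exact hα
  classical
  obtain ⟨k, hk⟩ : ∃ k, Nat.find hex = k + 1 :=
    Nat.exists_eq_succ_of_ne_zero fun h0 ↦ hαN ((partialSups F).mono (Nat.zero_le _)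
      (h0 ▸ Nat.find_spec hex))
  have hα1 : α ∈ partialSups F (k + 1) := hk ▸ Nat.find_spec hex
  have hα2 : α ∉ partialSups F k := Nat.find_min hex (by omega)
  -- Using `N + 1` rather than `N` as cutoff gives `1 ≤ k`, so `F 1` is among the earlier fields and
  -- can stand in for `F 0` in `hunr`.
  have hNk : N + 1 ≤ k := by
    by_contra! h
    exact hαN ((partialSups F).mono (show k + 1 ≤ N + 1 by omega) hα1)
  have hunr (j : ℕ) (hj : j ≤ k) :
      ∃ i ≤ k, F j ≤ F i ∧ ¬ RamifiesIn (p (k + 1)) (F i) := by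
    rcases Nat.eq_zero_or_pos j with rfl | hj0
    · exact ⟨1, by omega, hF 1 le_rfl, hunram (k + 1) 1 le_rfl (by omega)⟩
    · exact ⟨j, hj, le_rfl, hunram (k + 1) j hj0 (by omega)⟩
  have hle := le_absMulHeight₁_of_mem_partialSups F (hp (k + 1) (by omega))
    (htot (k + 1) (by omega)) hunr hα1 hα2
  have hbot : F (k + 1) ≠ ⊥ := by
    intro hb
    rw [partialSups_add_one, hb, sup_bot_eq] at hα1
    exact hα2 hα1
  have hmem : k + 1 ≤ N := by
    refine hN ⟨by omega, hbot, hle.trans ?_⟩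
    have h0 := absMulHeight₁_nonneg α
    have h1 := hdim (k + 1) (by omega)
    calc _ ≤ Y ^ (Module.finrank ℚ (F (k + 1)) * Module.finrank ℚ (F (k + 1))) := by
          gcongr
          exact mul_le_mul_of_nonneg_left
            (pow_le_pow_left₀ h0 (hαX.trans (le_max_left _ _)) 2) zero_le_two
      _ ≤ _ := pow_le_pow_right₀ hY (Nat.mul_le_mul h1 h1)
  omega
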